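/- Let $G$ be a simple undirected graph. For nonnegative integers $r,k$, a vertex $v$ and a set $A\subseteq V(G)$, the $r$-profile of $v$ with respect to $A$ is the function on $A$ sending $a$ to $\operatorname{dist}_G(a,v)$ if this distance is at most $r$, and to $+\infty$ otherwise. Let $\mathrm{pc}_r(G,A)$ be the number of distinct $r$-profiles with respect to $A$ of the vertices of $G$, not counting the profile that is constantly $+\infty$, and let $\mathrm{pc}_r(G,k)$ be the maximum of $\mathrm{pc}_r(G,A)$ over all $A\subseteq V(G)$ with $|A|=k$ (and $0$ if there is no such $A$). For all integers $h\ge 4$, $r\ge 0$, $k\ge 0$ and every graph $G$ that excludes $K_h$ as a minor, $$\mathrm{pc}_r(G,k)\le 4^h\,(h-3)\,h^{2(h-1)}\,(r+1)^{3(h-1)}\,k .$$ In particular, $\mathrm{pc}_r(G,k)\in h^{O(h)}(r+1)^{3(h-1)}k$, and for $r\ge 1$ also $\mathrm{pc}_r(G,k)\in h^{O(h)}r^{3h-3}k$; that is, there is an absolute constant $C$ such that for all $h\ge 4$, $r\ge 0$, $k\ge 0$ and every graph $G$ excluding $K_h$ as a minor, $\mathrm{pc}_r(G,k)\le h^{Ch}(r+1)^{3(h-1)}k$,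 and, if moreover $r\ge 1$, $\mathrm{pc}_r(G,k)\le h^{Ch}r^{3h-3}k$. -/

import Mathlib

universe u v

namespace ProfileComplexity

/-- `H` is a minor of `G`: there is a minor model, i.e. pairwise disjoint branch sets in `G`, each
inducing a connected (in particular nonempty) subgraph, indexed by the vertices of `H`, such that
adjacent vertices of `H` have branch sets joined by an edge of `G`. -/
def IsMinor {W : Type v} {V : Type u} (H : SimpleGraph W) (G : SimpleGraph V) : Prop :=
  ∃ B : W → Set V,
    (∀ w, (G.induce (B w)).Connected) ∧
    (∀ w w', w ≠ w' → Disjoint (B w) (B w')) ∧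
    (∀ w w', H.Adj w w' → ∃ x ∈ B w, ∃ y ∈ B w', G.Adj x y)

open Classical in
/-- Truncation at `r`: distances larger than `r` (including infinite ones) are replaced by `+∞`. -/
noncomputable def cap (r : ℕ) (l : ℕ∞) : ℕ∞ :=
  if l ≤ (r : ℕ∞) then l else ⊤

/-- The `r`-profile of the vertex `x` with respect to `A`, a function on `A`. The extended distance
`SimpleGraph.edist` is `⊤` between vertices of different components. -/
noncomputable def profile {V : Type u} (G : SimpleGraph V) (r : ℕ) (A : Finset V) (x : V) :
    A → ℕ∞ :=
  fun a => cap r (G.edist a.1 x)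

/-- The number of distinct `r`-profiles with respect to `A`, not counting the all-`+∞` one. -/
noncomputable def profileCount {V : Type u} (G : SimpleGraph V) (r : ℕ) (A : Finset V) : ℕ∞ :=
  (Set.range (profile G r A) \ {fun _ => ⊤}).encard

/-- The `r`-profile complexity of `G` at `k`: the maximum of the profile counts over all
`k`-element vertex sets `A` (each count is at most `(r + 2) ^ k`, so the supremum is attained
as soon as there is such an `A`; it is `0` if there is none). -/
noncomputable def profileComplexity {V : Type u} (G : SimpleGraph V) (r k : ℕ) : ℕ∞ :=
  ⨆ A : Finset V, ⨆ _ : A.card = k, profileCount G r A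

end ProfileComplexity

/-!
The bound is a product of two factors, both obtained from a partition of the graph into connected
parts that are unions of few geodesics.

A finite graph without a `K_h` minor is decomposed greedily. As long as vertices remain, take a
component of the remaining graph, pick geodesics of it from one vertex to neighbours of all the
earlier parts that the component touches, and let their union be the next part. The parts touched
by a component stay pairwise adjacent, so together with the component they form a model of a
complete graph, and there are at most `h - 2` of them. As a geodesic has at most `2 * r + 1`
vertices within distance `r` of a given vertex, each part has at most `(h - 2) * (2 * r + 1)` such
vertices, with distances measured in the graph of the vertices of the same or a later part
(`IsGeodesicPartition`, `exists_isGeodesicPartition`).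

Say that a vertex `y` is weakly reachable from `a` if a walk of length at most `r` joins them on
which `y` lies in the earliest part. The record minima along such a walk form a descending path in
the order of the parts, where each step goes to a touched part. This relation is chordal with at
most `h - 2` out-neighbours, so at most `(r + 1) ^ (h - 2)` parts are weakly reachable from `a`
(`card_reach_le`).

Given a vertex `v` near `A`, consider all walks of length at most `r` from `v` to `A`, choose one
whose earliest part is as late as possible, and let `y` be a vertex of that part on it. Every
geodesic of length at most `r` from `v` to `A` then meets the set `Z` of vertices strongly
reachable from `y` within distance `2 * r` (`exists_intercepts`). The set `Z` depends on `y` alone,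
and the profile of `v` on `Z` determines its profile on `A`. Unlike the number of weakly reachable
vertices, the size of `Z` is linear in `r`, since `Z` lies only in the part of `y` and in the parts
touched by its component.

It remains to count profiles on `Z`. If `h` balls were shattered by the vertices, their additively
weighted Voronoi cells would form a model of `K_h` (`isMinor_top_of_balls`). Hence the balls of
radius at most `r` around `Z` have VC-dimension less than `h` as a set system, and the
Sauer–Shelah lemma gives at most `(#Z * (r + 1) + 1) ^ (h - 1)` profiles
(`encard_range_profile_le`).

Infinite graphs reduce to finite ones, because finitely many profiles are already realised in a
finite induced subgraph containing the relevant shortest walks (`profileCount_le_of_forall_finite`).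
-/

namespace ProfileComplexity

open Finset

variable {V : Type u} {G : SimpleGraph V}

/-! ### Connected sets, distances and minors -/

lemma connected_induce_of_walks {s : Set V} {u : V} (hu : u ∈ s)
    (hs : ∀ v ∈ s, ∃ w : G.Walk v u, ∀ x ∈ w.support, x ∈ s) : (G.induce s).Connected := by
  refine G.induce_connected_of_patches u hu fun {v} hv => ?_
  obtain ⟨w, hw⟩ := hs v hv
  exact ⟨{x | x ∈ w.support}, hw, w.end_mem_support, w.start_mem_support,
    w.connected_induce_support.preconnected _ _⟩

lemma exists_adj_of_edist_eq_succ {c u : V} {n : ℕ} (h : G.edist c u = (n + 1 : ℕ)) :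
    ∃ w, G.Adj u w ∧ G.edist c w = n := by
  rw [SimpleGraph.edist_comm] at h
  obtain ⟨p, hp⟩ := G.exists_walk_of_edist_eq_coe h
  cases p with
  | nil => simp at hp
  | @cons _ w _ hadj q =>
    refine ⟨w, hadj, ?_⟩
    have hq : G.edist w c ≤ n := by
      have := G.edist_le q
      simp only [SimpleGraph.Walk.length_cons, Nat.add_right_cancel_iff] at hp
      rwa [hp] at this
    rw [SimpleGraph.edist_comm]
    refine le_antisymm hq ?_
    have h1 : G.edist u c ≤ G.edist u w + G.edist w c := G.edist_triangle
    rw [SimpleGraph.edist_eq_one_iff_adj.2 hadj, h] at h1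
    lift G.edist w c to ℕ using (hq.trans_lt (ENat.natCast_lt_top n)).ne with d
    norm_cast at h1 ⊢
    omega

lemma edist_le_edist_add_one (c : V) {u w : V} (h : G.Adj u w) :
    G.edist c u ≤ G.edist c w + 1 := by
  have := G.edist_triangle (u := c) (v := w) (w := u)
  rwa [SimpleGraph.edist_eq_one_iff_adj.2 h.symm] at this

lemma exists_walk_of_edist_le {u v : V} {n : ℕ} (h : G.edist u v ≤ n) :
    ∃ w : G.Walk u v, w.length ≤ n := by
  obtain ⟨w, hw⟩ := G.exists_walk_of_edist_ne_top (h.trans_lt (ENat.natCast_lt_top n)).ne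
  exact ⟨w, by rw [← hw] at h; exact_mod_cast h⟩

lemma IsMinor.of_induce {W : Type*} {H : SimpleGraph W} {U : Set V}
    (h : IsMinor H (G.induce U)) : IsMinor H G := by
  obtain ⟨B, hconn, hdisj, hadj⟩ := h
  refine ⟨fun w => Subtype.val '' B w, fun w => ?_, fun w w' hw => ?_, fun w w' hw => ?_⟩
  · let f : (G.induce U).induce (B w) →g G.induce (Subtype.val '' B w) :=
      { toFun := fun x => ⟨x.1.1, x.1, x.2, rfl⟩
        map_rel' := fun h => h }
    refine (hconn w).map f ?_
    rintro ⟨_, x, hx, rfl⟩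
    exact ⟨⟨x, hx⟩, rfl⟩
  · exact (Set.disjoint_image_iff Subtype.val_injective).2 (hdisj w w' hw)
  · obtain ⟨x, hx, y, hy, hxy⟩ := hadj w w' hw
    exact ⟨x, ⟨x, hx, rfl⟩, y, ⟨y, hy, rfl⟩, hxy⟩

/-- A finite family of at least `h` disjoint, connected, pairwise adjacent vertex sets is a model
of `K_h`. -/
lemma isMinor_top_of_finset {ι : Type*} {h : ℕ} (T : Finset ι) (hT : h ≤ T.card) (B : ι → Set V)
    (hconn : ∀ i ∈ T, (G.induce (B i)).Connected)
    (hdisj : ∀ i ∈ T, ∀ j ∈ T, i ≠ j → Disjoint (B i) (B j))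
    (hadj : ∀ i ∈ T, ∀ j ∈ T, i ≠ j → ∃ x ∈ B i, ∃ y ∈ B j, G.Adj x y) :
    IsMinor (⊤ : SimpleGraph (Fin h)) G := by
  obtain ⟨f⟩ : Nonempty (Fin h ↪ T) :=
    Function.Embedding.nonempty_of_card_le (by simpa using hT)
  have hf : ∀ w w', w ≠ w' → (f w : ι) ≠ f w' := fun w w' hw e => hw (f.injective (Subtype.ext e))
  exact ⟨fun w => B (f w), fun w => hconn _ (f w).2,
    fun w w' hw => hdisj _ (f w).2 _ (f w').2 (hf w w' hw),
    fun w w' hw => hadj _ (f w).2 _ (f w').2 (hf w w' ((SimpleGraph.top_adj _ _).1 hw))⟩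

/-! ### Balls in graphs without a complete minor -/

/-- The distance from the centre `c l`, shifted so that the ball of radius `ρ l` around `c l` is
the sublevel set at the common level `∑ l, ρ l`. -/
noncomputable def shiftedDist (G : SimpleGraph V) {h : ℕ} (c : Fin h → V) (ρ : Fin h → ℕ)
    (l : Fin h) (u : V) : ℕ∞ :=
  G.edist (c l) u + ((∑ j, ρ j) - ρ l : ℕ)

/-- The additively weighted Voronoi cell of the centre `c i`: the vertices whose shifted distance
to `c i` is finite and minimal, ties being resolved in favour of the smaller index. -/
def voronoiCell (G : SimpleGraph V) {h : ℕ} (c : Fin h → V) (ρ : Fin h → ℕ) (i : Fin h) : Set V :=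
  {u | shiftedDist G c ρ i u ≠ ⊤ ∧ (∀ l, shiftedDist G c ρ i u ≤ shiftedDist G c ρ l u) ∧
    ∀ l < i, shiftedDist G c ρ i u < shiftedDist G c ρ l u}

section Voronoi

variable {h : ℕ} {c : Fin h → V} {ρ : Fin h → ℕ}

lemma shiftedDist_le_iff {l : Fin h} {u : V} :
    shiftedDist G c ρ l u ≤ (∑ j, ρ j : ℕ) ↔ G.edist (c l) u ≤ ρ l := by
  have hl : ρ l ≤ ∑ j, ρ j := single_le_sum (fun _ _ => Nat.zero_le _) (mem_univ l)
  unfold shiftedDist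
  rcases eq_or_ne (G.edist (c l) u) ⊤ with e | e
  · simp only [e, top_add, top_le_iff, ENat.natCast_ne_top]
  · lift G.edist (c l) u to ℕ using e with d
    norm_cast
    omega

lemma shiftedDist_le_add_one (l : Fin h) {u w : V} (huw : G.Adj u w) :
    shiftedDist G c ρ l u ≤ shiftedDist G c ρ l w + 1 := by
  unfold shiftedDist
  rw [add_right_comm]
  gcongr
  exact edist_le_edist_add_one _ huw

lemma shiftedDist_eq_add_one {l : Fin h} {u w : V} {n : ℕ} (hu : G.edist (c l) u = (n + 1 : ℕ))
    (hw : G.edist (c l) w = n) : shiftedDist G c ρ l u = shiftedDist G c ρ l w + 1 := by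
  unfold shiftedDist
  rw [hu, hw, add_right_comm]
  norm_cast

lemma exists_mem_voronoiCell {l : Fin h} {u : V} (hu : shiftedDist G c ρ l u ≠ ⊤) :
    ∃ i, u ∈ voronoiCell G c ρ i := by
  obtain ⟨i, -, hi⟩ := exists_min_image univ
    (fun l => toLex (shiftedDist G c ρ l u, l)) ⟨l, mem_univ l⟩
  have key : ∀ l, shiftedDist G c ρ i u ≤ shiftedDist G c ρ l u ∧
      (l < i → shiftedDist G c ρ i u < shiftedDist G c ρ l u) := by
    intro l
    have := hi l (mem_univ l)
    rw [Prod.Lex.toLex_le_toLex] at this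
    rcases this with h1 | ⟨h1, h2⟩
    · exact ⟨h1.le, fun _ => h1⟩
    · exact ⟨h1.le, fun h3 => absurd h3 (not_lt.2 h2)⟩
  exact ⟨i, ((key l).1.trans_lt (lt_top_iff_ne_top.2 hu)).ne, fun l => (key l).1,
    fun l => (key l).2⟩

lemma disjoint_voronoiCell {i j : Fin h} (hij : i ≠ j) :
    Disjoint (voronoiCell G c ρ i) (voronoiCell G c ρ j) := by
  rw [Set.disjoint_left]
  rintro u ⟨-, hi, hi'⟩ ⟨-, hj, hj'⟩
  rcases lt_or_gt_of_ne hij with hlt | hlt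
  · exact (hj' i hlt).not_ge (hi j)
  · exact (hi' j hlt).not_ge (hj i)

/-- Voronoi cells are star-shaped: stepping towards the centre stays in the cell. -/
lemma mem_voronoiCell_of_adj {i : Fin h} {u w : V} {n : ℕ} (hu : u ∈ voronoiCell G c ρ i)
    (huw : G.Adj u w) (hun : G.edist (c i) u = (n + 1 : ℕ)) (hwn : G.edist (c i) w = n) :
    w ∈ voronoiCell G c ρ i := by
  obtain ⟨h0, h1, h2⟩ := hu
  rw [shiftedDist_eq_add_one hun hwn] at h0 h1 h2
  refine ⟨fun e => h0 (by rw [e, top_add]), fun l => ?_, fun l hl => ?_⟩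
  · exact (ENat.add_le_add_iff_right (by simp)).1 ((h1 l).trans (shiftedDist_le_add_one l huw))
  · exact (ENat.add_lt_add_iff_right (by simp)).1
      ((h2 l hl).trans_le (shiftedDist_le_add_one l huw))

lemma edist_ne_top_of_mem_voronoiCell {i : Fin h} {u : V} (hu : u ∈ voronoiCell G c ρ i) :
    G.edist (c i) u ≠ ⊤ := fun e => hu.1 (by rw [shiftedDist, e, top_add])

lemma exists_walk_in_voronoiCell {i : Fin h} {u : V} (hu : u ∈ voronoiCell G c ρ i) :
    ∃ w : G.Walk u (c i), ∀ x ∈ w.support, x ∈ voronoiCell G c ρ i := by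
  obtain ⟨n, hn⟩ := ENat.ne_top_iff_exists.1 (edist_ne_top_of_mem_voronoiCell hu)
  induction n generalizing u with
  | zero =>
    obtain rfl : c i = u := SimpleGraph.edist_eq_zero_iff.1 hn.symm
    exact ⟨.nil, by simpa using hu⟩
  | succ n ih =>
    obtain ⟨w, huw, hw⟩ := exists_adj_of_edist_eq_succ hn.symm
    obtain ⟨p, hp⟩ := ih (mem_voronoiCell_of_adj hu huw hn.symm hw) hw.symm
    exact ⟨.cons huw p, by simpa using ⟨hu, hp⟩⟩

/-- A vertex of the `i`-th cell for which every competitor other than `i` is farther than `c j`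
starts a geodesic towards `c j` that can only leave the `i`-th cell into the `j`-th one. -/
lemma exists_adj_voronoiCell {i j : Fin h} (hij : i ≠ j) (hc : c j ∈ voronoiCell G c ρ j) {u : V}
    (hu : u ∈ voronoiCell G c ρ i) (hfin : G.edist (c j) u ≠ ⊤)
    (hlt : ∀ l, l ≠ i → l ≠ j → shiftedDist G c ρ j u < shiftedDist G c ρ l u) :
    ∃ x ∈ voronoiCell G c ρ i, ∃ y ∈ voronoiCell G c ρ j, G.Adj x y := by
  obtain ⟨n, hn⟩ := ENat.ne_top_iff_exists.1 hfin
  induction n generalizing u with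
  | zero =>
    obtain rfl : c j = u := SimpleGraph.edist_eq_zero_iff.1 hn.symm
    exact absurd hc (Set.disjoint_left.1 (disjoint_voronoiCell hij) hu)
  | succ n ih =>
    obtain ⟨w, huw, hw⟩ := exists_adj_of_edist_eq_succ hn.symm
    have hlt' : ∀ l, l ≠ i → l ≠ j → shiftedDist G c ρ j w < shiftedDist G c ρ l w := by
      intro l hl hl'
      have := hlt l hl hl'
      rw [shiftedDist_eq_add_one hn.symm hw] at this
      exact (ENat.add_lt_add_iff_right (by simp)).1
        (this.trans_le (shiftedDist_le_add_one l huw))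
    have hwfin : shiftedDist G c ρ j w ≠ ⊤ := by
      rw [shiftedDist, hw]
      exact ENat.natCast_ne_top _
    obtain ⟨l, hl⟩ := exists_mem_voronoiCell hwfin
    by_cases hlj : l = j
    · exact ⟨u, hu, w, hlj ▸ hl, huw⟩
    by_cases hli : l = i
    · exact ih (hli ▸ hl) (by simp [hw]) hlt' hw.symm
    · exact absurd (hl.2.1 j) (hlt' l hli hlj).not_ge

/-- If for any two of `h` balls some vertex lies in these two balls and in no other one, then the
weighted Voronoi cells of the balls form a model of `K_h`. -/
lemma isMinor_top_of_balls (c : Fin h → V) (ρ : Fin h → ℕ)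
    (hpair : ∀ i j, ∃ v, ∀ l, G.edist (c l) v ≤ ρ l ↔ l = i ∨ l = j) :
    IsMinor (⊤ : SimpleGraph (Fin h)) G := by
  have hcell : ∀ i j v, (∀ l, G.edist (c l) v ≤ ρ l ↔ l = i ∨ l = j) →
      v ∈ voronoiCell G c ρ i ∨ v ∈ voronoiCell G c ρ j := by
    intro i j v hv
    have hi : shiftedDist G c ρ i v ≤ (∑ j, ρ j : ℕ) :=
      shiftedDist_le_iff.2 ((hv i).2 (Or.inl rfl))
    obtain ⟨l, hl⟩ := exists_mem_voronoiCell (hi.trans_lt (ENat.natCast_lt_top _)).ne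
    rcases (hv l).1 (shiftedDist_le_iff.1 ((hl.2.1 i).trans hi)) with rfl | rfl
    exacts [Or.inl hl, Or.inr hl]
  have hcent : ∀ i, c i ∈ voronoiCell G c ρ i := by
    intro i
    obtain ⟨v, hv⟩ := hpair i i
    obtain ⟨w, hw⟩ := exists_walk_in_voronoiCell ((hcell i i v hv).elim id id)
    exact hw _ w.end_mem_support
  have hadj : ∀ i j v, i ≠ j → (∀ l, G.edist (c l) v ≤ ρ l ↔ l = i ∨ l = j) →
      v ∈ voronoiCell G c ρ i →
      ∃ x ∈ voronoiCell G c ρ i, ∃ y ∈ voronoiCell G c ρ j, G.Adj x y := by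
    intro i j v hij hv hi
    have hj : G.edist (c j) v ≤ ρ j := (hv j).2 (Or.inr rfl)
    refine exists_adj_voronoiCell hij (hcent j) hi (hj.trans_lt (ENat.natCast_lt_top _)).ne ?_
    intro l hli hlj
    refine (shiftedDist_le_iff.2 hj).trans_lt (lt_of_not_ge fun hle => ?_)
    exact ((hv l).1 (shiftedDist_le_iff.1 hle)).elim hli hlj
  refine isMinor_top_of_finset univ (by simp) (voronoiCell G c ρ)
    (fun i _ => connected_induce_of_walks (hcent i) fun v hv => exists_walk_in_voronoiCell hv)
    (fun i _ j _ hij => disjoint_voronoiCell hij) fun i _ j _ hij => ?_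
  obtain ⟨v, hv⟩ := hpair i j
  rcases hcell i j v hv with hi | hj
  · exact hadj i j v hij hv hi
  · obtain ⟨x, hx, y, hy, hxy⟩ := hadj j i v hij.symm (fun l => (hv l).trans or_comm) hj
    exact ⟨y, hy, x, hx, hxy.symm⟩

end Voronoi

/-! ### Profiles with respect to a set, by the Sauer–Shelah lemma -/

lemma sum_choose_le_succ_pow (n d : ℕ) : ∑ k ∈ Iic d, n.choose k ≤ (n + 1) ^ d := by
  rw [add_pow, ← Nat.range_succ_eq_Iic]
  refine sum_le_sum fun k hk => ?_
  have hk : k ≤ d := Nat.lt_succ_iff.1 (mem_range.1 hk)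
  simpa using Nat.mul_le_mul (Nat.choose_le_pow n k) (Nat.choose_pos hk)

lemma encard_image_le_of_factors {α β γ : Type*} {f : α → β} {g : α → γ} {s : Set α}
    (hfg : ∀ a ∈ s, ∀ b ∈ s, g a = g b → f a = f b) : (f '' s).encard ≤ (g '' s).encard := by
  rcases s.eq_empty_or_nonempty with rfl | ⟨a, -⟩
  · simp
  have : Nonempty α := ⟨a⟩
  have hinv : ∀ b ∈ f '' s, Function.invFunOn f s b ∈ s ∧ f (Function.invFunOn f s b) = b :=
    fun b hb => ⟨Function.invFunOn_mem hb, Function.invFunOn_eq hb⟩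
  refine Set.encard_le_encard_of_injOn (f := fun b => g (Function.invFunOn f s b))
    (fun b hb => Set.mem_image_of_mem g (hinv b hb).1) fun b hb c hc e => ?_
  rw [← (hinv b hb).2, ← (hinv c hc).2]
  exact hfg _ (hinv b hb).1 _ (hinv c hc).1 e

lemma cap_eq_cap {r : ℕ} {a b : ℕ∞} (hab : ∀ i ≤ r, a ≤ i ↔ b ≤ i) : cap r a = cap r b := by
  unfold cap
  by_cases ha : a ≤ r
  · have hb : b ≤ r := (hab r le_rfl).1 ha
    rw [if_pos ha, if_pos hb]
    lift a to ℕ using (ha.trans_lt (ENat.natCast_lt_top r)).ne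
    lift b to ℕ using (hb.trans_lt (ENat.natCast_lt_top r)).ne
    exact le_antisymm ((hab b (by exact_mod_cast hb)).2 le_rfl)
      ((hab a (by exact_mod_cast ha)).1 le_rfl)
  · rw [if_neg ha, if_neg fun hb => ha ((hab r le_rfl).2 hb)]

lemma le_iff_of_cap_eq {r : ℕ} {a b : ℕ∞} (h : cap r a = cap r b) {i : ℕ} (hi : i ≤ r) :
    a ≤ i ↔ b ≤ i := by
  have hir : (i : ℕ∞) ≤ r := by exact_mod_cast hi
  unfold cap at h
  split_ifs at h with ha hb hb
  · rw [h]
  · exact absurd (h ▸ ha) (by simp)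
  · exact absurd (h ▸ hb) (by simp)
  · exact ⟨fun h' => absurd (h'.trans hir) ha, fun h' => absurd (h'.trans hir) hb⟩

open Classical in
/-- The balls of radius at most `r` around the vertices of `Z` that contain `v`. -/
noncomputable def ballsAround (G : SimpleGraph V) (r : ℕ) (Z : Finset V) (v : V) :
    Finset (Z × Fin (r + 1)) :=
  univ.filter fun b => G.edist b.1.1 v ≤ (b.2 : ℕ)

lemma profile_eq_iff_ballsAround_eq {r : ℕ} {Z : Finset V} {v w : V} :
    profile G r Z v = profile G r Z w ↔ ballsAround G r Z v = ballsAround G r Z w := by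
  constructor
  · intro e
    ext b
    simp only [ballsAround, mem_filter, mem_univ, true_and]
    exact le_iff_of_cap_eq (congr_fun e b.1) (Nat.lt_succ_iff.1 b.2.2)
  · intro e
    funext z
    refine cap_eq_cap fun i hi => ?_
    have := Finset.ext_iff.1 e (z, ⟨i, Nat.lt_succ_of_le hi⟩)
    simpa [ballsAround] using this

/-- Without a `K_h` minor, no `h` balls are shattered by the vertices, so the profiles with respect
to `Z` form a set system of VC-dimension less than `h` on `#Z * (r + 1)` balls. -/
lemma encard_range_profile_le {h : ℕ}
    (hG : ¬ IsMinor (⊤ : SimpleGraph (Fin h)) G) [Fintype V] (r : ℕ) (Z : Finset V) :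
    (Set.range (profile G r Z)).encard ≤ ((Z.card * (r + 1) + 1) ^ (h - 1) : ℕ) := by
  classical
  let 𝒜 : Finset (Finset (Z × Fin (r + 1))) := univ.image (ballsAround G r Z)
  have hvc : 𝒜.vcDim ≤ h - 1 := by
    refine Finset.sup_le fun s hs => ?_
    rw [mem_shatterer] at hs
    by_contra hlt
    have hcard : h ≤ s.card := by omega
    obtain ⟨f⟩ : Nonempty (Fin h ↪ s) :=
      Function.Embedding.nonempty_of_card_le (by simpa using hcard)
    refine hG (isMinor_top_of_balls (fun l => (f l).1.1.1) (fun l => ((f l).1.2 : ℕ)) ?_)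
    intro i j
    obtain ⟨t, ht, hst⟩ := hs (t := {(f i).1, (f j).1}) (by
      intro x hx
      rcases mem_insert.1 hx with rfl | hx
      · exact (f i).2
      · rw [mem_singleton.1 hx]; exact (f j).2)
    obtain ⟨v, -, rfl⟩ := mem_image.1 ht
    refine ⟨v, fun l => ?_⟩
    have := Finset.ext_iff.1 hst (f l).1
    simp only [ballsAround, mem_inter, (f l).2, mem_filter, mem_univ, true_and, mem_insert,
      mem_singleton, Subtype.val_inj, f.injective.eq_iff] at this
    exact this
  have hcard : 𝒜.card ≤ (Z.card * (r + 1) + 1) ^ (h - 1) := by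
    calc 𝒜.card ≤ 𝒜.shatterer.card := card_le_card_shatterer 𝒜
      _ ≤ ∑ k ∈ Iic 𝒜.vcDim, (Fintype.card (Z × Fin (r + 1))).choose k :=
        card_shatterer_le_sum_vcDim
      _ ≤ (Fintype.card (Z × Fin (r + 1)) + 1) ^ 𝒜.vcDim := sum_choose_le_succ_pow _ _
      _ = (Z.card * (r + 1) + 1) ^ 𝒜.vcDim := by simp
      _ ≤ _ := Nat.pow_le_pow_right (Nat.succ_pos _) hvc
  rw [← Set.image_univ]
  calc _ ≤ (ballsAround G r Z '' Set.univ).encard :=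
        encard_image_le_of_factors fun v _ w _ => profile_eq_iff_ballsAround_eq.2
    _ = (𝒜 : Set (Finset (Z × Fin (r + 1)))).encard := by simp [𝒜]
    _ = (𝒜.card : ℕ∞) := Set.encard_coe_eq_coe_finsetCard 𝒜
    _ ≤ _ := by exact_mod_cast hcard

/-! ### Partitions into unions of few geodesics -/

/-- The graph induced by the vertices of rank at least `i`, on the same vertex type: the vertices
of smaller rank are kept as isolated vertices. -/
def above (G : SimpleGraph V) (p : V → ℕ) (i : ℕ) : SimpleGraph V where
  Adj x y := G.Adj x y ∧ i ≤ p x ∧ i ≤ p y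
  symm := ⟨fun _ _ h => ⟨h.1.symm, h.2.2, h.2.1⟩⟩
  loopless := ⟨fun _ h => h.1.ne rfl⟩

/-- The ranks below `n` of the neighbours of the component of `x` in the graph induced by the
ranks at least `n`. -/
def touched (G : SimpleGraph V) (p : V → ℕ) (n : ℕ) (x : V) : Set ℕ :=
  {i | i < n ∧ ∃ y z, (above G p n).Reachable x y ∧ G.Adj y z ∧ p z = i}

/-- A partial partition of the vertices into parts `{p = i}` for `i < m`; the rank `m` marks the
vertices that are not yet assigned. Every part is connected and, within the graph induced by the
ranks from its own upwards, meets each ball of radius `r` in at most `q * (2 * r + 1)` vertices.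
Any two parts touched by a common component of the later vertices are adjacent. -/
structure IsGeodesicPartition (G : SimpleGraph V) (q m : ℕ) (p : V → ℕ) : Prop where
  le : ∀ x, p x ≤ m
  conn : ∀ x, p x < m → (G.induce {y | p y = p x}).Connected
  flat : ∀ i < m, ∀ (x : V) (r : ℕ) (S : Finset V),
    (∀ u ∈ S, p u = i ∧ (above G p i).edist x u ≤ r) → S.card ≤ q * (2 * r + 1)
  adj : ∀ n x, n ≤ p x → ∀ i ∈ touched G p n x, ∀ j ∈ touched G p n x, i < j →
    ∃ z z', p z = i ∧ p z' = j ∧ G.Adj z z'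

lemma above_le (p : V → ℕ) (i : ℕ) : above G p i ≤ G := fun _ _ h => h.1

lemma above_anti (p : V → ℕ) {i j : ℕ} (hij : i ≤ j) : above G p j ≤ above G p i :=
  fun _ _ h => ⟨h.1, hij.trans h.2.1, hij.trans h.2.2⟩

lemma above_walk_support {p : V → ℕ} {i : ℕ} {x y : V} (hx : i ≤ p x)
    (w : (above G p i).Walk x y) : ∀ z ∈ w.support, i ≤ p z := by
  induction w with
  | nil => simpa using hx
  | cons h w ih => simpa using ⟨hx, ih h.2.2⟩

lemma above_reachable_le {p : V → ℕ} {i : ℕ} {x y : V} (hx : i ≤ p x)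
    (h : (above G p i).Reachable x y) : i ≤ p y := by
  obtain ⟨w⟩ := h
  exact above_walk_support hx w _ w.end_mem_support

/-- A walk through ranks at least `i` is a walk of the same length in `above G p i`. -/
lemma exists_above_walk {p : V → ℕ} {i : ℕ} {x y : V} (w : G.Walk x y)
    (hw : ∀ z ∈ w.support, i ≤ p z) : ∃ w' : (above G p i).Walk x y, w'.length = w.length := by
  induction w with
  | nil => exact ⟨.nil, rfl⟩
  | cons h w ih =>
    obtain ⟨w', hw'⟩ := ih fun z hz => hw z (by simp [hz])
    exact ⟨.cons ⟨h, hw _ (by simp), hw _ (by simp)⟩ w', congr_arg (· + 1) hw'⟩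

lemma above_reachable_of_mem {p : V → ℕ} {i : ℕ} {x y : V}
    (hconn : (G.induce {y | p y = i}).Connected) (hx : p x = i) (hy : p y = i) :
    (above G p i).Reachable x y := by
  obtain ⟨w⟩ := hconn.preconnected ⟨x, hx⟩ ⟨y, hy⟩
  let f : G.induce {y | p y = i} →g above G p i :=
    { toFun := Subtype.val
      map_rel' := fun {a b} h => ⟨h, a.2.ge, b.2.ge⟩ }
  exact ⟨w.map f⟩

lemma touched_eq_of_reachable {p : V → ℕ} {n : ℕ} {x y : V} (h : (above G p n).Reachable x y) :
    touched G p n x = touched G p n y := by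
  ext i
  constructor
  · rintro ⟨hi, a, b, h1, h2⟩
    exact ⟨hi, a, b, h.symm.trans h1, h2⟩
  · rintro ⟨hi, a, b, h1, h2⟩
    exact ⟨hi, a, b, h.trans h1, h2⟩

/-- The touched parts are pairwise adjacent and all adjacent to the component that touches them;
together with this component they form a model of a complete graph. -/
lemma IsGeodesicPartition.card_touched {h q m : ℕ} {p : V → ℕ}
    (hG : ¬ IsMinor (⊤ : SimpleGraph (Fin h)) G) (hp : IsGeodesicPartition G q m p) {n : ℕ} {x : V}
    (hx : n ≤ p x) (T : Finset ℕ) (hT : ∀ i ∈ T, i ∈ touched G p n x) : T.card + 2 ≤ h := by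
  by_contra hlt
  let B : Option ℕ → Set V := fun o => o.elim {y | (above G p n).Reachable x y} fun i => {y | p y = i}
  have hdisj : ∀ i ∈ T, Disjoint (B none) (B (some i)) := by
    intro i hi
    rw [Set.disjoint_left]
    intro y hy hyi
    have h1 := above_reachable_le hx hy
    have h2 := (hT i hi).1
    have h3 : p y = i := hyi
    omega
  have hadj0 : ∀ i ∈ T, ∃ y ∈ B none, ∃ z ∈ B (some i), G.Adj y z := by
    intro i hi
    obtain ⟨-, y, z, hy, hyz, hz⟩ := hT i hi
    exact ⟨y, hy, z, hz, hyz⟩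
  refine hG (isMinor_top_of_finset (insertNone T) (by rw [card_insertNone]; omega) B ?_ ?_ ?_)
  · rintro (_ | i) hi
    · refine connected_induce_of_walks (u := x) (.refl _) fun y hy => ?_
      obtain ⟨w⟩ : (above G p n).Reachable x y := hy
      refine ⟨(w.mapLe (above_le p n)).reverse, fun z hz => ?_⟩
      classical
      simp only [SimpleGraph.Walk.support_reverse, List.mem_reverse,
        SimpleGraph.Walk.support_mapLe_eq_support] at hz
      exact ⟨w.takeUntil z hz⟩
    · obtain ⟨hin, -, z, -, -, hz⟩ := hT i (by simpa using hi)
      have := hp.conn z (by have := hp.le x; omega)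
      rw [hz] at this
      exact this
  · rintro (_ | i) hi (_ | j) hj hij
    · exact absurd rfl hij
    · exact hdisj j (by simpa using hj)
    · exact (hdisj i (by simpa using hi)).symm
    · rw [Set.disjoint_left]
      rintro y hy hy'
      exact hij (congr_arg some (Eq.trans (Eq.symm hy) hy'))
  · rintro (_ | i) hi (_ | j) hj hij
    · exact absurd rfl hij
    · exact hadj0 j (by simpa using hj)
    · obtain ⟨y, hy, z, hz, hyz⟩ := hadj0 i (by simpa using hi)
      exact ⟨z, hz, y, hy, hyz.symm⟩
    · have hi := hT i (by simpa using hi)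
      have hj := hT j (by simpa using hj)
      rcases lt_or_gt_of_ne fun e => hij (congr_arg some e) with hlt | hlt
      · obtain ⟨z, z', hz, hz', hzz⟩ := hp.adj n x hx i hi j hj hlt
        exact ⟨z, hz, z', hz', hzz⟩
      · obtain ⟨z, z', hz, hz', hzz⟩ := hp.adj n x hx j hj i hi hlt
        exact ⟨z', hz', z, hz, hzz.symm⟩

/-- The vertex set of a geodesic from `v` to `t`, recorded by its two essential properties: it is
connected, and its vertices have distinct distances to `v`. -/
lemma exists_geodesic {H : SimpleGraph V} {v t : V} (ht : H.Reachable v t) :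
    ∃ P : Set V, v ∈ P ∧ t ∈ P ∧ P.InjOn (H.dist v) ∧
      ∀ x ∈ P, ∃ w : H.Walk x v, ∀ y ∈ w.support, y ∈ P := by
  obtain ⟨n, hn⟩ := ENat.ne_top_iff_exists.1 (SimpleGraph.edist_ne_top_iff_reachable.2 ht)
  suffices ∃ P : Set V, v ∈ P ∧ t ∈ P ∧ P.InjOn (H.dist v) ∧
      (∀ x ∈ P, ∃ w : H.Walk x v, ∀ y ∈ w.support, y ∈ P) ∧ ∀ x ∈ P, H.dist v x ≤ n by
    obtain ⟨P, h1, h2, h3, h4, -⟩ := this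
    exact ⟨P, h1, h2, h3, h4⟩
  clear ht
  induction n generalizing t with
  | zero =>
    obtain rfl : v = t := SimpleGraph.edist_eq_zero_iff.1 hn.symm
    refine ⟨{v}, rfl, rfl, Set.injOn_singleton _ _, ?_, by simp⟩
    rintro x rfl
    exact ⟨.nil, by simp⟩
  | succ n ih =>
    obtain ⟨w, htw, hw⟩ := exists_adj_of_edist_eq_succ hn.symm
    obtain ⟨P, hv, hwP, hinj, hwalk, hle⟩ := ih hw.symm
    have htd : H.dist v t = n + 1 := by
      rw [SimpleGraph.dist, ← hn]; rfl
    refine ⟨insert t P, Or.inr hv, Or.inl rfl, ?_, ?_, ?_⟩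
    · have htP : t ∉ P := fun h => by have := hle t h; omega
      rw [Set.injOn_insert htP]
      refine ⟨hinj, ?_⟩
      rintro ⟨x, hx, hxt⟩
      have := hle x hx
      omega
    · rintro x (rfl | hx)
      · obtain ⟨q, hq⟩ := hwalk w hwP
        refine ⟨.cons htw q, fun y hy => ?_⟩
        rw [SimpleGraph.Walk.support_cons, List.mem_cons] at hy
        exact hy.imp id (hq y)
      · obtain ⟨q, hq⟩ := hwalk x hx
        exact ⟨q, fun y hy => Or.inr (hq y hy)⟩
    · rintro x (rfl | hx)
      · exact htd.le
      · exact (hle x hx).trans n.le_succ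

/-- The vertices of a geodesic from `v` within distance `r` of `x` have their distances to `v` in
an interval of length `2 * r`. -/
lemma card_le_of_geodesic {H : SimpleGraph V} {v x : V} {r : ℕ} {P : Set V}
    (hinj : P.InjOn (H.dist v)) (hreach : ∀ u ∈ P, H.Reachable v u) (S : Finset V)
    (hSP : ∀ u ∈ S, u ∈ P) (hS : ∀ u ∈ S, H.edist x u ≤ r) : S.card ≤ 2 * r + 1 := by
  rcases S.eq_empty_or_nonempty with rfl | ⟨u₀, hu₀⟩
  · simp
  have hxu : ∀ u ∈ S, H.Reachable x u := fun u hu =>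
    SimpleGraph.edist_ne_top_iff_reachable.1 ((hS u hu).trans_lt (ENat.natCast_lt_top r)).ne
  have hvx : H.Reachable v x := (hreach u₀ (hSP u₀ hu₀)).trans (hxu u₀ hu₀).symm
  have hmaps : ∀ u ∈ S, H.dist v u ∈ Icc (H.dist v x - r) (H.dist v x + r) := by
    intro u hu
    have h1 : H.dist v u ≤ H.dist v x + H.dist x u := hvx.dist_triangle_left u
    have h2 : H.dist v x ≤ H.dist v u + H.dist u x :=
      (hreach u (hSP u hu)).dist_triangle_left x
    have h3 : H.dist x u ≤ r := by
      have := hS u hu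
      rw [← (hxu u hu).coe_dist_eq_edist] at this
      exact_mod_cast this
    rw [SimpleGraph.dist_comm (u := u)] at h2
    rw [mem_Icc]
    omega
  refine (card_le_card_of_injOn _ hmaps fun a ha b hb => hinj (hSP a ha) (hSP b hb)).trans ?_
  rw [Nat.card_Icc]
  omega

/-- A component of the unassigned vertices contains a next part: a union of geodesics from one
vertex that together touch every part touched by the component. -/
lemma IsGeodesicPartition.exists_succ {h m : ℕ} {p : V → ℕ} (hh : 3 ≤ h)
    (hG : ¬ IsMinor (⊤ : SimpleGraph (Fin h)) G) (hp : IsGeodesicPartition G (h - 2) m p) {x₀ : V}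
    (hx₀ : p x₀ = m) : ∃ p' : V → ℕ, IsGeodesicPartition G (h - 2) (m + 1) p' ∧
      {x | p' x = m + 1} ⊂ {x | p x = m} := by
  classical
  set K := above G p m with hK
  obtain ⟨T, hT⟩ : ∃ T : Finset ℕ, ∀ i, i ∈ T ↔ i ∈ touched G p m x₀ :=
    ⟨(range m).filter (· ∈ touched G p m x₀), fun i => by
      rw [mem_filter, mem_range]
      exact ⟨fun h => h.2, fun h => ⟨h.1, h⟩⟩⟩
  have hTcard := hp.card_touched hG hx₀.ge T fun i => (hT i).1
  -- the endpoints of the geodesics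
  obtain ⟨D, hDne, hDcard, hDreach, hDtouch⟩ : ∃ D : Finset V, D.Nonempty ∧ D.card ≤ h - 2 ∧
      (∀ t ∈ D, K.Reachable x₀ t) ∧ ∀ i ∈ T, ∃ t ∈ D, ∃ z, p z = i ∧ G.Adj t z := by
    rcases T.eq_empty_or_nonempty with rfl | hTne
    · exact ⟨{x₀}, singleton_nonempty _, by rw [card_singleton]; omega,
        fun t ht => by rw [mem_singleton.1 ht], by simp⟩
    · have htouch : ∀ i ∈ T, ∃ t, K.Reachable x₀ t ∧ ∃ z, p z = i ∧ G.Adj t z := by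
        intro i hi
        obtain ⟨-, y, z, hy, hyz, hz⟩ := (hT i).1 hi
        exact ⟨y, hy, z, hz, hyz⟩
      have : Nonempty V := ⟨x₀⟩
      choose! f hf hf' using htouch
      refine ⟨T.image f, hTne.image f, card_image_le.trans (by omega), ?_, ?_⟩
      · intro t ht
        obtain ⟨i, hi, rfl⟩ := mem_image.1 ht
        exact hf i hi
      · intro i hi
        exact ⟨f i, mem_image_of_mem f hi, hf' i hi⟩
  have hgeo := fun (t : V) (ht : t ∈ D) => exists_geodesic (hDreach t ht)
  choose! P hP0 hPt hPinj hPwalk using hgeo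
  let Q : Set V := {u | ∃ t ∈ D, u ∈ P t}
  have hx₀Q : x₀ ∈ Q := hDne.imp fun t ht => ⟨ht, hP0 t ht⟩
  have hPreach : ∀ t ∈ D, ∀ u ∈ P t, K.Reachable x₀ u := fun t ht u hu => by
    obtain ⟨w, -⟩ := hPwalk t ht u hu
    exact ⟨w.reverse⟩
  have hQreach : ∀ u ∈ Q, K.Reachable x₀ u := fun u ⟨t, ht, hu⟩ => hPreach t ht u hu
  have hQm : ∀ u ∈ Q, p u = m := fun u hu =>
    le_antisymm (hp.le u) (above_reachable_le hx₀.ge (hQreach u hu))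
  let p' : V → ℕ := fun x => if x ∈ Q then m else if p x = m then m + 1 else p x
  have hp'Q : ∀ x, p' x = m ↔ x ∈ Q := by
    intro x
    by_cases h1 : x ∈ Q <;> by_cases h2 : p x = m <;> simp [p', h1, h2]
  have hp'lt : ∀ x i, i < m → (p' x = i ↔ p x = i) := by
    intro x i hi
    by_cases h1 : x ∈ Q
    · simp only [p', h1, if_true, hQm x h1]
    · by_cases h2 : p x = m
      · simp only [p', h1, h2, if_true, if_false]; omega
      · simp only [p', h1, h2, if_false]
  have hp'le : ∀ x i, i ≤ m → (i ≤ p' x ↔ i ≤ p x) := by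
    intro x i hi
    by_cases h1 : x ∈ Q
    · simp only [p', h1, if_true, hQm x h1]
    · by_cases h2 : p x = m
      · simp only [p', h1, h2, if_true, if_false]; omega
      · simp only [p', h1, h2, if_false]
  have hp'top : ∀ x, m + 1 ≤ p' x → x ∉ Q ∧ p x = m := by
    intro x hx
    by_cases h1 : x ∈ Q
    · simp only [p', h1, if_true] at hx; omega
    · by_cases h2 : p x = m
      · exact ⟨h1, h2⟩
      · simp only [p', h1, h2, if_false] at hx
        have := hp.le x
        omega
  have habove : ∀ i ≤ m, above G p' i = above G p i := by
    intro i hi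
    ext x y
    simp only [above, hp'le _ i hi]
  have htouched : ∀ n ≤ m, ∀ x, touched G p' n x = touched G p n x := by
    intro n hn x
    ext i
    simp only [touched, habove n hn, Set.mem_ofPred_eq]
    refine and_congr_right fun hi => ?_
    simp only [hp'lt _ i (hi.trans_le hn)]
  refine ⟨p', ⟨?_, ?_, ?_, ?_⟩, ?_⟩
  · intro x
    have := hp.le x
    simp only [p']
    split_ifs <;> omega
  · intro x hx
    rcases Nat.lt_succ_iff_lt_or_eq.1 hx with hx | hx
    · have hpx := (hp'lt x _ hx).1 rfl
      have hset : {y | p' y = p' x} = {y | p y = p x} :=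
        Set.ext fun y => (hp'lt y _ hx).trans (by rw [hpx]; rfl)
      rw [hset]
      exact hp.conn x (by omega)
    · rw [hx]
      refine connected_induce_of_walks (u := x₀) ((hp'Q x₀).2 hx₀Q) fun u hu => ?_
      obtain ⟨t, ht, hut⟩ := (hp'Q u).1 hu
      obtain ⟨w, hw⟩ := hPwalk t ht u hut
      refine ⟨w.mapLe (above_le p m), fun y hy => ?_⟩
      rw [SimpleGraph.Walk.support_mapLe_eq_support] at hy
      exact (hp'Q y).2 ⟨t, ht, hw y hy⟩
  · intro i hi x r S hS
    rcases Nat.lt_succ_iff_lt_or_eq.1 hi with hi | rfl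
    · refine hp.flat i hi x r S fun u hu => ?_
      rw [← hp'lt u i hi, ← habove i hi.le]
      exact hS u hu
    · have hsub : S ⊆ D.biUnion fun t => S.filter (· ∈ P t) := by
        intro u hu
        obtain ⟨t, ht, hut⟩ := (hp'Q u).1 (hS u hu).1
        exact mem_biUnion.2 ⟨t, ht, mem_filter.2 ⟨hu, hut⟩⟩
      refine (card_le_card hsub).trans ((card_biUnion_le_card_mul _ _ (2 * r + 1) ?_).trans
        (Nat.mul_le_mul_right _ hDcard))
      intro t ht
      refine card_le_of_geodesic (x := x) (hPinj t ht) (hPreach t ht) _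
        (fun u hu => (mem_filter.1 hu).2) fun u hu => ?_
      rw [hK, ← habove i le_rfl]
      exact (hS u (mem_filter.1 hu).1).2
  · intro n x hnx i hi j hj hij
    rcases Nat.lt_or_ge m n with hmn | hnm
    · -- in the new stage, either both parts are old or the later one is the part just added
      have hle : above G p' n ≤ K := by
        rw [hK, ← habove m le_rfl]
        exact above_anti p' hmn.le
      obtain ⟨-, hxm⟩ := hp'top x (by omega)
      obtain ⟨hin, y, z, hxy, hyz, hz⟩ := hi
      obtain ⟨hjn, y', z', hxy', hyz', hz'⟩ := hj
      have hjm : j ≤ m := by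
        have h1 := hp'top x (by omega)
        have h2 : p' x = m + 1 := by simp [p', h1.1, h1.2]
        omega
      have hi' : i ∈ touched G p m x :=
        ⟨by omega, y, z, hxy.mono hle, hyz, (hp'lt z i (by omega)).1 hz⟩
      rcases hjm.lt_or_eq with hjm | rfl
      · have hj' : j ∈ touched G p m x :=
          ⟨hjm, y', z', hxy'.mono hle, hyz', (hp'lt z' j hjm).1 hz'⟩
        obtain ⟨a, b, ha, hb, hab⟩ := hp.adj m x hxm.ge i hi' j hj' hij
        exact ⟨a, b, (hp'lt a i (by omega)).2 ha, (hp'lt b j hjm).2 hb, hab⟩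
      · have hz'Q := (hp'Q z').1 hz'
        have hy' := above_reachable_le hnx hxy'
        have hyz'K : K.Adj y' z' := ⟨hyz', (hp'top y' (by omega)).2.ge, (hQm z' hz'Q).ge⟩
        have hreach : K.Reachable x x₀ :=
          ((hxy'.mono hle).trans hyz'K.reachable).trans (hQreach z' hz'Q).symm
        rw [touched_eq_of_reachable hreach, ← hT] at hi'
        obtain ⟨t, ht, a, ha, hta⟩ := hDtouch i hi'
        exact ⟨a, t, (hp'lt a i hij).2 ha, (hp'Q t).2 ⟨t, ht, hPt t ht⟩, hta.symm⟩
    · rw [htouched n hnm] at hi hj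
      obtain ⟨z, z', hz, hz', hzz⟩ := hp.adj n x ((hp'le x n hnm).1 hnx) i hi j hj hij
      exact ⟨z, z', (hp'lt z i (hi.1.trans_le hnm)).2 hz, (hp'lt z' j (hj.1.trans_le hnm)).2 hz',
        hzz⟩
  · refine ⟨fun x hx => (hp'top x (le_of_eq (Eq.symm hx))).2, fun hsub => ?_⟩
    exact (hp'top x₀ (le_of_eq (Eq.symm (hsub hx₀)))).1 hx₀Q

lemma exists_isGeodesicPartition [Finite V] {h : ℕ} (hh : 3 ≤ h)
    (hG : ¬ IsMinor (⊤ : SimpleGraph (Fin h)) G) :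
    ∃ m p, IsGeodesicPartition G (h - 2) m p ∧ ∀ x, p x < m := by
  suffices ∀ (n m : ℕ) (p : V → ℕ), IsGeodesicPartition G (h - 2) m p →
      {x | p x = m}.ncard = n → ∃ m p, IsGeodesicPartition G (h - 2) m p ∧ ∀ x, p x < m by
    refine this _ 0 (fun _ => 0) ⟨fun _ => le_rfl, fun x hx => absurd hx (lt_irrefl 0),
      fun i hi => absurd hi (Nat.not_lt_zero i), fun n x hx i hi => ?_⟩ rfl
    exact absurd (hi.1.trans_le hx) (Nat.not_lt_zero i)
  intro n
  induction n using Nat.strong_induction_on with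
  | _ n ih =>
    intro m p hp hn
    by_cases hx : ∃ x, p x = m
    · obtain ⟨x, hx⟩ := hx
      obtain ⟨p', hp', hlt⟩ := hp.exists_succ hh hG hx
      exact ih _ (hn ▸ Set.ncard_lt_ncard hlt (Set.toFinite _)) _ p' hp' rfl
    · exact ⟨m, p, hp, fun x => lt_of_le_of_ne (hp.le x) fun e => hx ⟨x, e⟩⟩

/-! ### Descending paths in chordal orders -/

/-- The endpoints of the paths with at most `r` steps that start in `j` and always step from `i`
to an element of `N i`. -/
def reach (N : ℕ → Finset ℕ) : ℕ → ℕ → Finset ℕ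
  | 0, j => {j}
  | r + 1, j => insert j ((N j).biUnion (reach N r))

lemma self_mem_reach (N : ℕ → Finset ℕ) (r j : ℕ) : j ∈ reach N r j := by
  cases r <;> simp [reach]

lemma mem_reach_succ {N : ℕ → Finset ℕ} {r i j b : ℕ} (hb : b ∈ N j) (hi : i ∈ reach N r b) :
    i ∈ reach N (r + 1) j :=
  mem_insert_of_mem (mem_biUnion.2 ⟨b, hb, hi⟩)

lemma reach_succ_subset (N : ℕ → Finset ℕ) (r j : ℕ) : reach N r j ⊆ reach N (r + 1) j := by
  induction r generalizing j with
  | zero =>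
    intro i hi
    rw [mem_singleton.1 hi]
    exact self_mem_reach N _ j
  | succ r ih =>
    intro i hi
    rcases mem_insert.1 hi with rfl | hi
    · exact self_mem_reach N _ i
    · obtain ⟨b, hb, hi⟩ := mem_biUnion.1 hi
      exact mem_reach_succ hb (ih b hi)

lemma reach_mono (N : ℕ → Finset ℕ) {r s : ℕ} (hrs : r ≤ s) (j : ℕ) : reach N r j ⊆ reach N s j :=
  monotone_nat_of_le_succ (f := fun r => reach N r j) (fun r => reach_succ_subset N r j) hrs

/-- The out-neighbours above `a`, kept only at the elements that have `a` as an out-neighbour. -/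
def restrictAbove (N : ℕ → Finset ℕ) (a i : ℕ) : Finset ℕ :=
  if a ∈ N i then (N i).filter (a < ·) else ∅

/-- A descending path that passes below `a` can be rerouted through `a`. -/
lemma reach_subset_union {N : ℕ → Finset ℕ}
    (hch : ∀ j, ∀ a ∈ N j, ∀ b ∈ N j, a < b → a ∈ N b) {a : ℕ} (r : ℕ) {i : ℕ} (hi : a ∈ N i) :
    reach N r i ⊆ reach N r a ∪ reach (restrictAbove N a) r i := by
  induction r generalizing i with
  | zero => exact subset_union_right
  | succ r ih =>
    intro x hx
    rw [mem_union]
    rcases mem_insert.1 hx with rfl | hx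
    · exact Or.inr (self_mem_reach _ _ x)
    obtain ⟨b, hb, hx⟩ := mem_biUnion.1 hx
    rcases lt_trichotomy b a with hba | rfl | hab
    · exact Or.inl (mem_reach_succ (hch i b hb a hi hba) hx)
    · exact Or.inl (reach_succ_subset N r b hx)
    · rcases mem_union.1 (ih (hch i a hi b hb hab) hx) with hx | hx
      · exact Or.inl (reach_succ_subset N r a hx)
      · refine Or.inr (mem_reach_succ (b := b) ?_ hx)
        rw [restrictAbove, if_pos hi]
        exact mem_filter.2 ⟨hb, hab⟩

/-- Split the endpoints at the smallest out-neighbour `a` of `j`: those not above `a` are reached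
from `a` with one step less, and the paths above `a` use one out-neighbour less at every step. -/
lemma card_reach_le {N : ℕ → Finset ℕ} {k : ℕ} (hch : ∀ j, ∀ a ∈ N j, ∀ b ∈ N j, a < b → a ∈ N b)
    (hk : ∀ j, (N j).card ≤ k) (r j : ℕ) : (reach N r j).card ≤ (r + 1) ^ k := by
  induction k generalizing N r j with
  | zero =>
    have hN : ∀ j, N j = ∅ := fun j => card_eq_zero.1 (Nat.le_zero.1 (hk j))
    cases r <;> simp [reach, hN]
  | succ k ihk =>
    induction r generalizing j with
    | zero => simp [reach]
    | succ r ihr =>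
      rcases (N j).eq_empty_or_nonempty with hj | hj
      · simp only [reach, hj, biUnion_empty, insert_empty_eq, card_singleton]
        exact Nat.one_le_pow _ _ (Nat.succ_pos _)
      obtain ⟨a, ha, hmin⟩ := (N j).exists_min_image id hj
      have hsub : reach N (r + 1) j ⊆ reach N r a ∪ reach (restrictAbove N a) (r + 1) j := by
        intro x hx
        rw [mem_union]
        rcases mem_insert.1 hx with rfl | hx
        · exact Or.inr (self_mem_reach _ _ x)
        obtain ⟨b, hb, hx⟩ := mem_biUnion.1 hx
        rcases (show a ≤ b from hmin b hb).eq_or_lt with rfl | hab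
        · exact Or.inl hx
        · rcases mem_union.1 (reach_subset_union hch r (hch j a ha b hb hab) hx) with hx | hx
          · exact Or.inl hx
          · refine Or.inr (mem_reach_succ (b := b) ?_ hx)
            rw [restrictAbove, if_pos ha]
            exact mem_filter.2 ⟨hb, hab⟩
      have hch' : ∀ j, ∀ b ∈ restrictAbove N a j, ∀ c ∈ restrictAbove N a j, b < c →
          b ∈ restrictAbove N a c := by
        intro j b hb c hc hbc
        by_cases haj : a ∈ N j
        · rw [restrictAbove, if_pos haj, mem_filter] at hb hc
          rw [restrictAbove, if_pos (hch j a haj c hc.1 hc.2), mem_filter]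
          exact ⟨hch j b hb.1 c hc.1 hbc, hb.2⟩
        · rw [restrictAbove, if_neg haj] at hb
          exact absurd hb (notMem_empty b)
      have hk' : ∀ j, (restrictAbove N a j).card ≤ k := by
        intro j
        by_cases haj : a ∈ N j
        · rw [restrictAbove, if_pos haj]
          have hlt : (N j).filter (a < ·) ⊂ N j :=
            filter_ssubset.2 ⟨a, haj, lt_irrefl a⟩
          have := card_lt_card hlt
          have := hk j
          omega
        · simp [restrictAbove, haj]
      calc (reach N (r + 1) j).card
          ≤ (reach N r a).card + (reach (restrictAbove N a) (r + 1) j).card :=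
            (card_le_card hsub).trans (card_union_le _ _)
        _ ≤ (r + 1) ^ (k + 1) + (r + 1 + 1) ^ k := add_le_add (ihr a) (ihk hch' hk' _ _)
        _ ≤ (r + 1) * (r + 1 + 1) ^ k + (r + 1 + 1) ^ k := by
            rw [pow_succ']
            gcongr
            omega
        _ = (r + 1 + 1) ^ (k + 1) := by ring

/-! ### Counting profiles in finite graphs -/

open Classical in
/-- The parts touched by the component of the part `j` among the ranks at least `j`. -/
noncomputable def touchedParts (G : SimpleGraph V) (p : V → ℕ) (j : ℕ) : Finset ℕ :=
  (range j).filter fun i => ∃ x, p x = j ∧ i ∈ touched G p j x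

lemma mem_touchedParts {p : V → ℕ} {i j : ℕ} :
    i ∈ touchedParts G p j ↔ ∃ x, p x = j ∧ i ∈ touched G p j x := by
  classical
  rw [touchedParts, mem_filter, mem_range]
  exact ⟨fun h => h.2, fun h => ⟨h.choose_spec.2.1, h⟩⟩

namespace IsGeodesicPartition

variable {h q m : ℕ} {p : V → ℕ}

lemma mem_touched_of_mem_touchedParts (hp : IsGeodesicPartition G q m p) (hm : ∀ x, p x < m)
    {i : ℕ} {x : V} (hi : i ∈ touchedParts G p (p x)) : i ∈ touched G p (p x) x := by
  obtain ⟨y, hy, hi⟩ := mem_touchedParts.1 hi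
  rwa [touched_eq_of_reachable (above_reachable_of_mem (hp.conn x (hm x)) rfl hy)]

lemma card_touchedParts (hG : ¬ IsMinor (⊤ : SimpleGraph (Fin h)) G)
    (hp : IsGeodesicPartition G q m p) (hm : ∀ x, p x < m) (j : ℕ) :
    (touchedParts G p j).card ≤ h - 2 := by
  rcases (touchedParts G p j).eq_empty_or_nonempty with he | ⟨i, hi⟩
  · simp [he]
  · obtain ⟨x, rfl, -⟩ := mem_touchedParts.1 hi
    have := hp.card_touched hG le_rfl (touchedParts G p (p x))
      fun i hi => hp.mem_touched_of_mem_touchedParts hm hi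
    omega

lemma touchedParts_chordal (hp : IsGeodesicPartition G q m p) (hm : ∀ x, p x < m) (j : ℕ) :
    ∀ a ∈ touchedParts G p j, ∀ b ∈ touchedParts G p j, a < b → a ∈ touchedParts G p b := by
  intro a ha b hb hab
  obtain ⟨x, rfl, -⟩ := mem_touchedParts.1 ha
  obtain ⟨z, z', hz, hz', hzz⟩ := hp.adj _ x le_rfl a (hp.mem_touched_of_mem_touchedParts hm ha) b
    (hp.mem_touched_of_mem_touchedParts hm hb) hab
  exact mem_touchedParts.2 ⟨z', hz', hab, z', z, .refl _, hzz.symm, hz⟩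

end IsGeodesicPartition

/-- The successive rank minima of a walk that ends in its minimal rank form a descending path. -/
lemma mem_reach_of_walk {p : V → ℕ} {i : ℕ} {x y : V} (w : (above G p i).Walk x y)
    (hy : p y = i) {j : ℕ} {x' : V} (hx' : p x' = j) (hreach : (above G p j).Reachable x' x)
    (hij : i ≤ j) : i ∈ reach (touchedParts G p) w.length j := by
  induction w generalizing j x' with
  | nil =>
    have := above_reachable_le hx'.ge hreach
    obtain rfl : i = j := by omega
    exact self_mem_reach _ _ _
  | @cons x u y hadj w ih =>
    have hjx := above_reachable_le hx'.ge hreach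
    rcases le_or_gt j (p u) with hju | huj
    · have hxu : (above G p j).Adj x u := ⟨hadj.1, hjx, hju⟩
      exact reach_succ_subset _ _ _ (ih hy hx' (hreach.trans hxu.reachable) hij)
    · refine mem_reach_succ (b := p u) ?_ (ih hy rfl (.refl _) hadj.2.2)
      exact mem_touchedParts.2 ⟨x', hx', huj, x, u, hreach, hadj.1, rfl⟩

open Classical in
/-- The vertices weakly reachable from `A`: those joined to a vertex of `A` by a walk of length at
most `r` on which their rank is minimal. -/
noncomputable def weakReach [Fintype V] (G : SimpleGraph V) (p : V → ℕ) (r : ℕ) (A : Finset V) :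
    Finset V :=
  A.biUnion fun a => univ.filter fun y => (above G p (p y)).edist a y ≤ r

open Classical in
/-- The vertices `z` strongly reachable from `y` at the level of parts: the part of `z` is that of
`y` or is touched by its component, and a walk of length at most `r` from `y` to `z` stays in the
ranks at least that of `z`. -/
noncomputable def strongReach [Fintype V] (G : SimpleGraph V) (p : V → ℕ) (r : ℕ) (y : V) :
    Finset V :=
  univ.filter fun z => p z ∈ insert (p y) (touchedParts G p (p y)) ∧
    (above G p (p z)).edist y z ≤ r

namespace IsGeodesicPartition

variable {h q m : ℕ} {p : V → ℕ}

lemma card_weakReach_le [Fintype V] (hG : ¬ IsMinor (⊤ : SimpleGraph (Fin h)) G)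
    (hp : IsGeodesicPartition G q m p) (hm : ∀ x, p x < m) (r : ℕ) (A : Finset V) :
    (weakReach G p r A).card ≤ A.card * ((r + 1) ^ (h - 2) * (q * (2 * r + 1))) := by
  classical
  refine card_biUnion_le_card_mul _ _ _ fun a _ => ?_
  have hsub : (univ.filter fun y => (above G p (p y)).edist a y ≤ r) ⊆
      (reach (touchedParts G p) r (p a)).biUnion fun i =>
        univ.filter fun y => p y = i ∧ (above G p i).edist a y ≤ r := by
    intro y hy
    have hy := (mem_filter.1 hy).2
    obtain ⟨w, hw⟩ := exists_walk_of_edist_le hy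
    have hya : p y ≤ p a := above_reachable_le le_rfl ⟨w.reverse⟩
    exact mem_biUnion.2 ⟨p y, reach_mono _ hw _ (mem_reach_of_walk w rfl rfl (.refl _) hya),
      mem_filter.2 ⟨mem_univ _, rfl, hy⟩⟩
  refine (card_le_card hsub).trans ((card_biUnion_le_card_mul _ _ (q * (2 * r + 1)) ?_).trans
    (Nat.mul_le_mul_right _ (card_reach_le (hp.touchedParts_chordal hm)
      (hp.card_touchedParts hG hm) r (p a))))
  intro i _
  rcases lt_or_ge i m with him | hmi
  · exact hp.flat i him a r _ fun u hu => (mem_filter.1 hu).2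
  · rw [filter_eq_empty_iff.2 fun y _ hy => absurd (hm y) (by omega)]
    simp

lemma card_strongReach_le [Fintype V] (hG : ¬ IsMinor (⊤ : SimpleGraph (Fin h)) G)
    (hp : IsGeodesicPartition G q m p) (hm : ∀ x, p x < m) (r : ℕ) (y : V) :
    (strongReach G p r y).card ≤ (h - 2 + 1) * (q * (2 * r + 1)) := by
  classical
  have hsub : strongReach G p r y ⊆ (insert (p y) (touchedParts G p (p y))).biUnion fun i =>
      univ.filter fun z => p z = i ∧ (above G p i).edist y z ≤ r := by
    intro z hz
    obtain ⟨-, hz, hz'⟩ := mem_filter.1 hz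
    exact mem_biUnion.2 ⟨p z, hz, mem_filter.2 ⟨mem_univ _, rfl, hz'⟩⟩
  refine (card_le_card hsub).trans ((card_biUnion_le_card_mul _ _ (q * (2 * r + 1)) ?_).trans
    (Nat.mul_le_mul_right _ ((card_insert_le _ _).trans
      (Nat.succ_le_succ (hp.card_touchedParts hG hm _)))))
  intro i _
  rcases lt_or_ge i m with him | hmi
  · exact hp.flat i him y r _ fun u hu => (mem_filter.1 hu).2
  · rw [filter_eq_empty_iff.2 fun z _ hz => absurd (hm z) (by omega)]
    simp

end IsGeodesicPartition

/-- A walk that meets the ranks at most `j` splits at its first vertex of that kind. -/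
lemma exists_first_le {p : V → ℕ} {j : ℕ} {v a : V} (w : G.Walk v a)
    (hw : ∃ x ∈ w.support, p x ≤ j) :
    ∃ z, ∃ w₁ : G.Walk v z, ∃ w₂ : G.Walk z a, w₁.length + w₂.length = w.length ∧ p z ≤ j ∧
      ∀ x ∈ w₁.support, x = z ∨ j < p x := by
  induction w with
  | @nil v =>
    obtain ⟨x, hx, hxj⟩ := hw
    rw [SimpleGraph.Walk.support_nil, List.mem_singleton] at hx
    exact ⟨v, .nil, .nil, rfl, hx ▸ hxj, by simp⟩
  | @cons v u a hadj w ih =>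
    by_cases hv : p v ≤ j
    · exact ⟨v, .nil, .cons hadj w, by simp, hv, by simp⟩
    · obtain ⟨x, hx, hxj⟩ := hw
      rw [SimpleGraph.Walk.support_cons, List.mem_cons] at hx
      have hxw : x ∈ w.support := hx.resolve_left (by rintro rfl; exact hv hxj)
      obtain ⟨z, w₁, w₂, hlen, hz, hw₁⟩ := ih ⟨x, hxw, hxj⟩
      refine ⟨z, .cons hadj w₁, w₂, by simp only [SimpleGraph.Walk.length_cons]; omega, hz, ?_⟩
      intro y hy
      rw [SimpleGraph.Walk.support_cons, List.mem_cons] at hy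
      rcases hy with rfl | hy
      · exact Or.inr (not_le.1 hv)
      · exact hw₁ y hy

lemma mem_touched_of_walk {p : V → ℕ} {j : ℕ} {x z : V} (w : G.Walk x z) (hx : j ≤ p x)
    (hz : p z < j) (hw : ∀ y ∈ w.support, y = z ∨ j < p y) : p z ∈ touched G p j x := by
  induction w with
  | nil => omega
  | @cons x u z hadj w ih =>
    rcases hw u (by simp) with rfl | hu
    · exact ⟨hz, x, u, .refl _, hadj, rfl⟩
    · have hxu : (above G p j).Adj x u := ⟨hadj, hx, hu.le⟩
      rw [touched_eq_of_reachable hxu.reachable]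
      exact ih hu.le hz fun y hy => hw y (by simp [hy])

/-- `Z` meets a geodesic between `v` and every vertex of `A` at distance at most `r` from `v`. -/
def Intercepts (G : SimpleGraph V) (r : ℕ) (A Z : Finset V) (v : V) : Prop :=
  ∀ a ∈ A, G.edist a v ≤ r → ∃ z ∈ Z, G.edist a z + G.edist z v ≤ G.edist a v

lemma profile_eq_of_intercepts {r : ℕ} {A Z : Finset V} {v w : V} (hv : Intercepts G r A Z v)
    (hw : Intercepts G r A Z w) (hvw : profile G r Z v = profile G r Z w) :
    profile G r A v = profile G r A w := by
  have key : ∀ v w, Intercepts G r A Z v → profile G r Z v = profile G r Z w →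
      ∀ a ∈ A, ∀ i ≤ r, G.edist a v ≤ i → G.edist a w ≤ i := by
    intro v w hv hvw a ha i hi hav
    obtain ⟨z, hz, hsum⟩ := hv a ha (hav.trans (by exact_mod_cast hi))
    have hzi : G.edist z v ≤ i := (le_add_self.trans hsum).trans hav
    obtain ⟨d, hd⟩ := ENat.ne_top_iff_exists.1 (hzi.trans_lt (ENat.natCast_lt_top i)).ne
    have hdi : d ≤ i := by rw [← hd] at hzi; exact_mod_cast hzi
    have hzw : G.edist z w ≤ G.edist z v := by
      rw [← hd]
      exact (le_iff_of_cap_eq (congr_fun hvw ⟨z, hz⟩) (hdi.trans hi)).1 hd.ge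
    calc G.edist a w ≤ G.edist a z + G.edist z w := G.edist_triangle
      _ ≤ G.edist a z + G.edist z v := by gcongr
      _ ≤ _ := hsum.trans hav
  funext a
  exact cap_eq_cap fun i hi => ⟨key v w hv hvw a a.2 i hi, key w v hw hvw.symm a a.2 i hi⟩

/-- Among the walks of length at most `r` from `v` to `A`, take one whose minimal rank `j` is as
large as possible, and let `y` be a vertex of rank `j` on it. Every other such walk reaches a rank
at most `j`, and the first time this happens is at a vertex strongly reachable from `y`. -/
lemma exists_intercepts [Fintype V] (p : V → ℕ) {r : ℕ} {A : Finset V} {v a₀ : V} (ha₀ : a₀ ∈ A)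
    (hv : G.edist a₀ v ≤ r) :
    ∃ y ∈ weakReach G p r A, Intercepts G r A (strongReach G p (2 * r) y) v := by
  classical
  let J : ℕ → Prop := fun j => ∃ a ∈ A, ∃ w : G.Walk v a, w.length ≤ r ∧ ∀ x ∈ w.support, j ≤ p x
  have hJ0 : J 0 := by
    obtain ⟨w, hw⟩ := exists_walk_of_edist_le hv
    exact ⟨a₀, ha₀, w.reverse, by simpa using hw, fun _ _ => Nat.zero_le _⟩
  have hJv : ∀ j, J j → j ≤ p v := fun j ⟨_, _, w, _, hw⟩ => hw v w.start_mem_support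
  obtain ⟨j, hj, hmax⟩ : ∃ j, J j ∧ ¬ J (j + 1) := by
    by_contra hcon
    push Not at hcon
    have hall : ∀ j, J j := fun j => Nat.rec hJ0 hcon j
    exact absurd (hJv _ (hall (p v + 1))) (by omega)
  obtain ⟨a, ha, w, hwr, hwj⟩ := hj
  obtain ⟨y, hy, hyj⟩ : ∃ y ∈ w.support, p y = j := by
    by_contra hcon
    push Not at hcon
    exact hmax ⟨a, ha, w, hwr, fun x hx => lt_of_le_of_ne (hwj x hx) (hcon x hx).symm⟩
  have hlen : (w.takeUntil y hy).length + (w.dropUntil y hy).length = w.length := by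
    rw [← SimpleGraph.Walk.length_append, SimpleGraph.Walk.take_spec]
  have htake : ∀ x ∈ (w.takeUntil y hy).support, j ≤ p x := fun x hx =>
    hwj x (w.support_takeUntil_subset_support hy hx)
  refine ⟨y, ?_, ?_⟩
  · obtain ⟨w', hw'⟩ := exists_above_walk (p := p) (i := j) (w.dropUntil y hy) fun x hx =>
      hwj x (w.support_dropUntil_subset_support hy hx)
    refine mem_biUnion.2 ⟨a, ha, mem_filter.2 ⟨mem_univ _, ?_⟩⟩
    rw [hyj, SimpleGraph.edist_comm]
    refine (SimpleGraph.edist_le w').trans ?_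
    exact_mod_cast (show w'.length ≤ r by omega)
  · intro b hb hbv
    rw [SimpleGraph.edist_comm] at hbv
    obtain ⟨g, hg⟩ :=
      G.exists_walk_of_edist_ne_top (hbv.trans_lt (ENat.natCast_lt_top r)).ne
    have hgr : g.length ≤ r := by rw [← hg] at hbv; exact_mod_cast hbv
    obtain ⟨z, w₁, w₂, hsum, hzj, hw₁⟩ := exists_first_le (p := p) (j := j) g (by
      by_contra hcon
      push Not at hcon
      exact hmax ⟨b, hb, g, hgr, hcon⟩)
    refine ⟨z, mem_filter.2 ⟨mem_univ _, ?_, ?_⟩, ?_⟩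
    · rw [mem_insert, hyj]
      rcases hzj.eq_or_lt with hzj | hzj
      · exact Or.inl hzj
      · refine Or.inr (mem_touchedParts.2 ⟨y, hyj, ?_⟩)
        obtain ⟨w', -⟩ := exists_above_walk _ htake
        rw [← touched_eq_of_reachable ⟨w'⟩]
        exact mem_touched_of_walk w₁ (hwj v w.start_mem_support) hzj hw₁
    · obtain ⟨w', hw'⟩ := exists_above_walk (p := p) (i := p z)
        ((w.takeUntil y hy).reverse.append w₁) (by
          intro x hx
          rw [SimpleGraph.Walk.mem_support_append_iff, SimpleGraph.Walk.support_reverse,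
            List.mem_reverse] at hx
          rcases hx with hx | hx
          · exact hzj.trans (htake x hx)
          · rcases hw₁ x hx with rfl | hx
            exacts [le_rfl, hzj.trans hx.le])
      refine (SimpleGraph.edist_le w').trans ?_
      rw [SimpleGraph.Walk.length_append, SimpleGraph.Walk.length_reverse] at hw'
      exact_mod_cast (show w'.length ≤ 2 * r by omega)
    · calc G.edist b z + G.edist z v ≤ w₂.reverse.length + w₁.reverse.length :=
          add_le_add (SimpleGraph.edist_le _) (SimpleGraph.edist_le _)
        _ = g.length := by
          rw [SimpleGraph.Walk.length_reverse, SimpleGraph.Walk.length_reverse, ← hsum]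
          push_cast
          exact add_comm _ _
        _ = G.edist b v := by rw [hg, SimpleGraph.edist_comm]

/-- The first factor counts the vertices weakly reachable from `A`, the second one the profiles
with respect to a set of strongly reachable vertices. -/
lemma profileCount_le_of_fintype [Fintype V] {h : ℕ} (hh : 3 ≤ h)
    (hG : ¬ IsMinor (⊤ : SimpleGraph (Fin h)) G) (r : ℕ) (A : Finset V) :
    profileCount G r A ≤ (A.card * ((r + 1) ^ (h - 2) * ((h - 2) * (2 * r + 1))) *
      ((h - 2 + 1) * ((h - 2) * (2 * (2 * r) + 1)) * (r + 1) + 1) ^ (h - 1) : ℕ) := by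
  classical
  obtain ⟨m, p, hp, hm⟩ := exists_isGeodesicPartition hh hG
  let S : V → Finset (A → ℕ∞) := fun y =>
    (univ.filter (Intercepts G r A (strongReach G p (2 * r) y))).image (profile G r A)
  have hsub : Set.range (profile G r A) \ {fun _ => ⊤} ⊆
      ((weakReach G p r A).biUnion S : Finset (A → ℕ∞)) := by
    rintro _ ⟨⟨v, rfl⟩, hv⟩
    obtain ⟨a, ha⟩ : ∃ a : A, G.edist a.1 v ≤ r := by
      by_contra hcon
      push Not at hcon
      exact hv (funext fun a => if_neg (hcon a).not_ge)
    obtain ⟨y, hy, hyv⟩ := exists_intercepts p a.2 ha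
    exact mem_coe.2 (mem_biUnion.2 ⟨y, hy, mem_image_of_mem _ (by simpa using hyv)⟩)
  have hS : ∀ y ∈ weakReach G p r A, (S y).card ≤
      ((h - 2 + 1) * ((h - 2) * (2 * (2 * r) + 1)) * (r + 1) + 1) ^ (h - 1) := by
    intro y _
    set Z := strongReach G p (2 * r) y
    have hle : ((S y).card : ℕ∞) ≤ ((Z.card * (r + 1) + 1) ^ (h - 1) : ℕ) := by
      calc ((S y).card : ℕ∞) = (profile G r A '' {v | Intercepts G r A Z v}).encard := by
            rw [← Set.encard_coe_eq_coe_finsetCard]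
            simp [S, Z]
        _ ≤ (profile G r Z '' {v | Intercepts G r A Z v}).encard :=
            encard_image_le_of_factors fun v hv w hw => profile_eq_of_intercepts hv hw
        _ ≤ (Set.range (profile G r Z)).encard :=
            Set.encard_le_encard (Set.image_subset_range _ _)
        _ ≤ _ := encard_range_profile_le hG r Z
    refine (Nat.cast_le.1 hle).trans ?_
    gcongr
    exact hp.card_strongReach_le hG hm (2 * r) y
  refine (Set.encard_le_encard hsub).trans ?_
  rw [Set.encard_coe_eq_coe_finsetCard, Nat.cast_le]
  exact (card_biUnion_le_card_mul _ _ _ hS).trans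
    (Nat.mul_le_mul_right _ (hp.card_weakReach_le hG hm r A))

/-! ### Reduction to finite graphs -/

lemma exists_finset_walks (G : SimpleGraph V) (a x : V) : ∃ S : Finset V,
    ∀ i : ℕ, G.edist a x ≤ i → ∃ w : G.Walk a x, w.length ≤ i ∧ ∀ y ∈ w.support, y ∈ S := by
  classical
  by_cases hax : G.edist a x = ⊤
  · exact ⟨∅, fun i hi => absurd (hax ▸ hi) (by simp)⟩
  · obtain ⟨w, hw⟩ := G.exists_walk_of_edist_ne_top hax
    refine ⟨w.support.toFinset, fun i hi => ⟨w, ?_, by simp⟩⟩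
    rw [← hw] at hi
    exact_mod_cast hi

lemma induce_edist_le_iff {U : Set V} {a x : U} {i : ℕ}
    (h : G.edist a.1 x.1 ≤ i → ∃ w : G.Walk a.1 x.1, w.length ≤ i ∧ ∀ y ∈ w.support, y ∈ U) :
    (G.induce U).edist a x ≤ i ↔ G.edist a.1 x.1 ≤ i := by
  constructor
  · intro hi
    obtain ⟨w, hw⟩ := exists_walk_of_edist_le hi
    refine (SimpleGraph.edist_le (w.map (SimpleGraph.Embedding.induce U).toHom)).trans ?_
    rw [SimpleGraph.Walk.length_map]
    exact_mod_cast hw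
  · intro hi
    obtain ⟨w, hw, hU⟩ := h hi
    refine (SimpleGraph.edist_le (w.induce U hU)).trans ?_
    have hlen := congr_arg SimpleGraph.Walk.length (w.map_induce hU)
    rw [SimpleGraph.Walk.length_map] at hlen
    rw [hlen]
    exact_mod_cast hw

/-- Finitely many profiles with respect to `A` survive in the finite subgraph induced by shortest
walks between `A` and vertices that realise these profiles. -/
lemma profileCount_le_of_forall_finite {r N : ℕ} {A : Finset V}
    (hN : ∀ U : Set V, U.Finite → ∀ A' : Finset U, A'.card = A.card →
      profileCount (G.induce U) r A' ≤ N) : profileCount G r A ≤ N := by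
  classical
  by_contra hlt
  rw [not_le, ← ENat.add_one_le_iff (by simp)] at hlt
  obtain ⟨t, ht, htN⟩ := Set.exists_subset_encard_eq hlt
  obtain ⟨X, hXt, hinj⟩ := Set.exists_image_eq_injOn_of_subset_range
    (ht.trans Set.sdiff_subset)
  have hXN : X.encard = N + 1 := by rw [← htN, ← hXt, hinj.encard_image]
  have hXfin : X.Finite := Set.finite_of_encard_eq_coe (k := N + 1) (by exact_mod_cast hXN)
  choose S hS using exists_finset_walks G
  let U : Set V := A ∪ X ∪ ⋃ a ∈ A, ⋃ x ∈ X, S a x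
  have hAU : ∀ a ∈ A, a ∈ U := fun a ha => Or.inl (Or.inl ha)
  have hXU : ∀ x ∈ X, x ∈ U := fun x hx => Or.inl (Or.inr hx)
  have hSU : ∀ a ∈ A, ∀ x ∈ X, ∀ y ∈ S a x, y ∈ U := fun a ha x hx y hy =>
    Or.inr (Set.mem_biUnion ha (Set.mem_biUnion hx hy))
  have hUfin : U.Finite := (A.finite_toSet.union hXfin).union
    (A.finite_toSet.biUnion fun a _ => hXfin.biUnion fun x _ => (S a x).finite_toSet)
  let A' : Finset U := A.subtype (· ∈ U)
  have hA' : A'.card = A.card := by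
    rw [card_subtype, filter_true_of_mem hAU]
  have hcap : ∀ (a : V) (ha : a ∈ A) (x : U), x.1 ∈ X →
      cap r ((G.induce U).edist ⟨a, hAU a ha⟩ x) = cap r (G.edist a x.1) := by
    intro a ha x hx
    refine cap_eq_cap fun i _ => induce_edist_le_iff fun hi => ?_
    obtain ⟨w, hw, hwS⟩ := hS a x.1 i hi
    exact ⟨w, hw, fun y hy => hSU a ha x.1 hx y (hwS y hy)⟩
  have himage : t = (fun x : U => profile G r A x.1) '' {x | x.1 ∈ X} := by
    rw [← hXt]
    ext f
    constructor
    · rintro ⟨x, hx, rfl⟩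
      exact ⟨⟨x, hXU x hx⟩, hx, rfl⟩
    · rintro ⟨x, hx, rfl⟩
      exact ⟨x.1, hx, rfl⟩
  have hle : t.encard ≤ profileCount (G.induce U) r A' := by
    rw [himage]
    refine (encard_image_le_of_factors (g := profile (G.induce U) r A') ?_).trans
      (Set.encard_le_encard ?_)
    · intro x hx y hy e
      funext a
      have := congr_fun e ⟨⟨a.1, hAU a.1 a.2⟩, mem_subtype.2 a.2⟩
      exact (hcap a.1 a.2 x hx).symm.trans (this.trans (hcap a.1 a.2 y hy))
    · rintro _ ⟨x, hx, rfl⟩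
      refine ⟨⟨x, rfl⟩, fun e => ?_⟩
      have hxt : profile G r A x.1 ∈ t := hXt ▸ Set.mem_image_of_mem _ hx
      refine (ht hxt).2 (funext fun a => ?_)
      have := congr_fun e ⟨⟨a.1, hAU a.1 a.2⟩, mem_subtype.2 a.2⟩
      exact (hcap a.1 a.2 x hx).symm.trans this
  have := htN ▸ hle.trans (hN U hUfin A' hA')
  exact absurd ((ENat.add_one_le_iff (by simp)).1 this) (lt_irrefl _)

/-! ### Numerical estimates -/

/-- A set of strongly reachable vertices yields fewer than `4 * h ^ 2 * (r + 1) ^ 2` balls, and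
the factor `(h - 2) * (2 * r + 1)` is at most `4 * (h - 3) * (r + 1)`. The first factor `4` enters
with the exponent `h - 1`, and together they give `4 ^ h`. -/
lemma count_le_bound {h : ℕ} (hh : 4 ≤ h) (r k : ℕ) :
    k * ((r + 1) ^ (h - 2) * ((h - 2) * (2 * r + 1))) *
      ((h - 2 + 1) * ((h - 2) * (2 * (2 * r) + 1)) * (r + 1) + 1) ^ (h - 1) ≤
    4 ^ h * (h - 3) * h ^ (2 * (h - 1)) * (r + 1) ^ (3 * (h - 1)) * k := by
  obtain ⟨n, rfl⟩ := Nat.exists_eq_add_of_le' hh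
  have e1 : n + 4 - 2 = n + 2 := rfl
  have e2 : n + 4 - 1 = n + 3 := rfl
  have e3 : n + 4 - 3 = n + 1 := rfl
  rw [e1, e2, e3]
  have h1 : (n + 2) * (2 * r + 1) ≤ 4 * (n + 1) * (r + 1) := by nlinarith
  have h2 : (n + 2 + 1) * ((n + 2) * (2 * (2 * r) + 1)) * (r + 1) + 1 ≤
      4 * (n + 4) ^ 2 * (r + 1) ^ 2 := by
    have : (4 * r + 1) * (r + 1) ≤ 4 * (r + 1) ^ 2 := by nlinarith
    calc (n + 2 + 1) * ((n + 2) * (2 * (2 * r) + 1)) * (r + 1) + 1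
        = (n + 3) * (n + 2) * ((4 * r + 1) * (r + 1)) + 1 := by ring
      _ ≤ (n + 3) * (n + 2) * (4 * (r + 1) ^ 2) + 4 * (r + 1) ^ 2 :=
          add_le_add (Nat.mul_le_mul_left _ this) (by nlinarith)
      _ = ((n + 3) * (n + 2) + 1) * (4 * (r + 1) ^ 2) := by ring
      _ ≤ (n + 4) ^ 2 * (4 * (r + 1) ^ 2) := Nat.mul_le_mul_right _ (by nlinarith)
      _ = _ := by ring
  calc _ ≤ k * ((r + 1) ^ (n + 2) * (4 * (n + 1) * (r + 1))) *
        (4 * (n + 4) ^ 2 * (r + 1) ^ 2) ^ (n + 3) := by gcongr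
    _ = _ := by
      rw [mul_pow, mul_pow, ← pow_mul, ← pow_mul]
      ring

lemma bound_le_pow {h : ℕ} (hh : 4 ≤ h) :
    4 ^ h * (h - 3) * h ^ (2 * (h - 1)) ≤ h ^ (4 * h) := by
  calc 4 ^ h * (h - 3) * h ^ (2 * (h - 1)) ≤ h ^ h * h ^ h * h ^ (2 * h) := by
        have h1 : h - 3 ≤ h ^ h := (Nat.sub_le h 3).trans (Nat.le_self_pow (by omega) h)
        gcongr <;> omega
    _ = _ := by rw [← pow_add, ← pow_add]; congr 1; omega

lemma succ_pow_le {h r : ℕ} (hh : 4 ≤ h) (hr : 1 ≤ r) :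
    (r + 1) ^ (3 * (h - 1)) ≤ h ^ (2 * h) * r ^ (3 * h - 3) := by
  have e : 3 * h - 3 = 3 * (h - 1) := by omega
  rw [e]
  calc (r + 1) ^ (3 * (h - 1)) ≤ (2 * r) ^ (3 * (h - 1)) := by gcongr; omega
    _ = (2 ^ 3) ^ (h - 1) * r ^ (3 * (h - 1)) := by rw [mul_pow, ← pow_mul]
    _ ≤ (h ^ 2) ^ h * r ^ (3 * (h - 1)) := by
        have h1 : 2 ^ 3 ≤ h ^ 2 := by nlinarith
        have h2 : (2 ^ 3) ^ (h - 1) ≤ (h ^ 2) ^ h :=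
          (Nat.pow_le_pow_left h1 _).trans (Nat.pow_le_pow_right (by positivity) (Nat.sub_le h 1))
        gcongr
    _ = _ := by rw [← pow_mul]

lemma profileComplexity_le {h : ℕ} (hh : 4 ≤ h) (hG : ¬ IsMinor (⊤ : SimpleGraph (Fin h)) G)
    (r k : ℕ) : profileComplexity G r k ≤
      ((4 ^ h * (h - 3) * h ^ (2 * (h - 1)) * (r + 1) ^ (3 * (h - 1)) * k : ℕ) : ℕ∞) := by
  refine iSup₂_le fun A hA => profileCount_le_of_forall_finite fun U hU A' hA' => ?_
  have : Fintype U := hU.fintype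
  refine (profileCount_le_of_fintype (by omega) (fun hmin => hG hmin.of_induce) r A').trans ?_
  rw [hA', hA]
  exact_mod_cast count_le_bound hh r k

end ProfileComplexity

theorem mainTheorem2 :
    (∀ (V : Type u) (G : SimpleGraph V) (h r k : ℕ), 4 ≤ h →
      ¬ ProfileComplexity.IsMinor (⊤ : SimpleGraph (Fin h)) G →
      ProfileComplexity.profileComplexity G r k ≤
        ((4 ^ h * (h - 3) * h ^ (2 * (h - 1)) * (r + 1) ^ (3 * (h - 1)) * k : ℕ) : ℕ∞)) ∧
    (∃ C : ℕ, ∀ (V : Type u) (G : SimpleGraph V) (h r k : ℕ), 4 ≤ h →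
      ¬ ProfileComplexity.IsMinor (⊤ : SimpleGraph (Fin h)) G →
      ProfileComplexity.profileComplexity G r k ≤
        ((h ^ (C * h) * (r + 1) ^ (3 * (h - 1)) * k : ℕ) : ℕ∞) ∧
      (1 ≤ r → ProfileComplexity.profileComplexity G r k ≤
        ((h ^ (C * h) * r ^ (3 * h - 3) * k : ℕ) : ℕ∞))) := by
  refine ⟨fun V G h r k hh hG => ProfileComplexity.profileComplexity_le hh hG r k,
    6, fun V G h r k hh hG => ?_⟩
  have hmain := ProfileComplexity.profileComplexity_le hh hG r k
  have hbound := ProfileComplexity.bound_le_pow hh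
  refine ⟨hmain.trans (Nat.cast_le.2 ?_), fun hr => hmain.trans (Nat.cast_le.2 ?_)⟩
  · have hpow : h ^ (4 * h) ≤ h ^ (6 * h) := Nat.pow_le_pow_right (by omega) (by omega)
    exact Nat.mul_le_mul_right _ (Nat.mul_le_mul_right _ (hbound.trans hpow))
  · refine Nat.mul_le_mul_right _ ?_
    calc _ ≤ h ^ (4 * h) * (h ^ (2 * h) * r ^ (3 * h - 3)) :=
          Nat.mul_le_mul hbound (ProfileComplexity.succ_pow_le hh hr)
      _ = h ^ (6 * h) * r ^ (3 * h - 3) := by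
          rw [← mul_assoc, ← pow_add]
          congr 2
          omega
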